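/- For positive integers $k,q$ and an integer $n\ge 0$, let $N_k(q,n)$ be the smallest integer $N$ such that every colouring with $q$ colours of all $k$-element subsets (edges) of $\{1,\dots,N\}$ contains a monochromatic monotone path of length $n$, that is, vertices $x_1<x_2<\cdots<x_{n+k-1}$ such that the $n$ edges $\{x_i,x_{i+1},\dots,x_{i+k-1}\}$, $1\le i\le n$, all have the same colour. Let $t_1(x)=x$ and $t_{j+1}(x)=2^{t_j(x)}$ for $j\ge 1$ and real $x$, so that $t_j(x)$ is a tower of $j-1$ twos with $x$ at the top. Let $k\ge 3$. Then $N_k(2,n)$ exists (is finite) for every $n$, and $$N_k(2,n)=t_{k-1}\big((2-o(1))\,n\big)\qquad(n\to\infty),$$ that is, there is a sequence $\varepsilon_n\to 0$ (depending on $k$) such that for all sufficiently large $n$ one has $\varepsilon_n\ge 0$ and $N_k(2,n)=t_{k-1}((2-\varepsilon_n)n)$. In particular $N_k(2,n)=t_{k-1}(\Theta(n))$ (which answers a question of Eliáš and Matoušek): there are constants $a,b>0$, depending only on $k$, with $t_{k-1}(an)\le N_k(2,n)\le t_{k-1}(bn)$ for all sufficiently large $n$. -/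

import Mathlib

open Filter Topology

/-- The edges of the complete `k`-uniform hypergraph `K^k_N` on the ordered vertex set `Fin N`:
all `k`-element subsets of the vertices. -/
abbrev KEdge (k N : ℕ) : Type := {e : Finset (Fin N) // e.card = k}

/-- The `i`-th edge `{x_i, x_{i+1}, …, x_{i+k-1}}` (for `i < n`) of the monotone path of length `n`
given by the vertices `x_0 < x_1 < ⋯ < x_{n+k-2}`. The length is the number `n` of edges. -/
def pathEdge {k n N : ℕ} (x : Fin (n + k - 1) ↪o Fin N) (i : Fin n) : KEdge k N :=
  ⟨Finset.univ.map
    ⟨fun j : Fin k => x ⟨(i : ℕ) + (j : ℕ), by omega⟩, fun a b h => by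
      have h' := x.injective h
      simp only [Fin.mk.injEq] at h'
      exact Fin.ext (by omega)⟩, by simp⟩

/-- The edge colouring `c` has a monochromatic monotone path of length `n`: all the `n` edges of
some monotone path have one and the same colour. -/
def HasMonoPath {k q N : ℕ} (c : KEdge k N → Fin q) (n : ℕ) : Prop :=
  ∃ (x : Fin (n + k - 1) ↪o Fin N) (a : Fin q), ∀ i : Fin n, c (pathEdge x i) = a

/-- The set of all `N` such that every `q`-colouring of the edges of `K^k_N` contains a
monochromatic monotone path of length `n`. -/
def ramseySet (k q n : ℕ) : Set ℕ :=
  {N | ∀ c : KEdge k N → Fin q, HasMonoPath c n}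

/-- `N_k(q,n)`, the smallest `N` such that every `q`-colouring of the edges of `K^k_N` contains a
monochromatic monotone path of length `n`. -/
noncomputable def ramseyN (k q n : ℕ) : ℕ := sInf (ramseySet k q n)

/-- The tower `t_k(x)` of height `k - 1` with `x` at the top:
`t_1(x) = x`, `t_2(x) = 2^x`, `t_3(x) = 2^(2^x)`, … (used for `k ≥ 1`). -/
noncomputable def tower (k : ℕ) (x : ℝ) : ℝ := (fun y : ℝ => (2 : ℝ) ^ y)^[k - 1] x

/-! Record, for each increasing `(k-1)`-tuple and each colour, the length of the longest
monochromatic path ending there. A colouring without a path of length `n` thus becomes a map to the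
poset `[n]^q` that never weakly decreases under a shift, and every such map gives back a colouring.
One coordinate of the tuple can be traded for one passage from a poset to its lower sets
(`ShiftAvoiding.exists_lowerSet`, `ShiftAvoiding.exists_of_lowerSet`). Down at single vertices only
the size of the poset matters, so `N_k(q,n)` is exactly one more than the size of the `(k-2)`-fold
lower-set lattice over `[n]^q` (`ramseyN_eq`).

For `q = 2` the first lattice has `centralBinom n = 4^(n - o(n))` elements. Each further one is at
most exponential in the previous, and at least 2 to the power of a large antichain, a rank level
(`rpow_div_le_card_lowerSet_lowerSet`). The loss is absorbed by any decrease of the constant 2 at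
the top of the tower. -/

/-! ### Shift-avoiding maps and iterated lower sets. -/

/-- The set of values of an increasing `k`-tuple, as an edge. -/
def edgeOfTuple {k N : ℕ} (x : Fin k → Fin N) (hx : StrictMono x) : KEdge k N :=
  ⟨Finset.univ.map ⟨x, hx.injective⟩, by simp⟩

/-- `f` never decreases (weakly) along a shift of increasing `m`-tuples. -/
def ShiftAvoiding {m N : ℕ} {P : Type*} [LE P] (f : (Fin m → Fin N) → P) : Prop :=
  ∀ x : Fin (m + 1) → Fin N, StrictMono x → ¬ f (Fin.tail x) ≤ f (Fin.init x)

theorem StrictMono.fin_init {m N : ℕ} {x : Fin (m + 1) → Fin N} (hx : StrictMono x) :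
    StrictMono (Fin.init x : Fin m → Fin N) :=
  fun _ _ h => hx (Fin.castSucc_lt_castSucc_iff.2 h)

theorem StrictMono.fin_tail {m N : ℕ} {x : Fin (m + 1) → Fin N} (hx : StrictMono x) :
    StrictMono (Fin.tail x : Fin m → Fin N) :=
  fun _ _ h => hx (Fin.succ_lt_succ_iff.2 h)

/-- Send `x` to the lower closure of the values of `f` on left extensions of `x`. If `f x` lay below
`f z` with `tail z = init x`, then `z` and `x` would glue to a longer tuple violating the hypothesis
on `f`. -/
theorem ShiftAvoiding.exists_lowerSet {m N : ℕ} {P : Type*} [PartialOrder P]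
    {f : (Fin (m + 2) → Fin N) → P} (hf : ShiftAvoiding f) :
    ∃ g : (Fin (m + 1) → Fin N) → LowerSet P, ShiftAvoiding g := by
  refine ⟨fun x => lowerClosure {p | ∃ z, StrictMono z ∧ Fin.tail z = x ∧ f z = p}, ?_⟩
  intro x hx hle
  have hmem : f x ∈ lowerClosure
      {p | ∃ z : Fin (m + 2) → Fin N, StrictMono z ∧ Fin.tail z = Fin.tail x ∧ f z = p} :=
    subset_lowerClosure ⟨x, hx, rfl, rfl⟩
  obtain ⟨_, ⟨z, hz, hzx, rfl⟩, hlt⟩ := mem_lowerClosure.1 (hle hmem)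
  have h1 : (Fin.init (Fin.cons (z 0) x : Fin (m + 3) → Fin N) : Fin (m + 2) → Fin N) = z := by
    funext i
    refine Fin.cases ?_ (fun j => ?_) i
    · rfl
    · have := congrFun hzx j
      simpa [Fin.init, Fin.tail, Fin.castSucc_succ] using this.symm
  refine hf (Fin.cons (z 0) x) ?_ (by rw [h1]; simpa [Fin.tail_cons] using hlt)
  have hx0 : z 0 < x 0 := by
    have := congrFun hzx 0
    simp only [Fin.tail, Fin.init] at this
    have h2 : z 0 < z (Fin.succ 0) := hz (Fin.succ_pos 0)
    rw [this] at h2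
    exact h2
  intro i j hij
  induction i using Fin.cases with
  | zero =>
    induction j using Fin.cases with
    | zero => exact absurd hij (lt_irrefl _)
    | succ j => simpa using hx0.trans_le (hx.monotone (Fin.zero_le j))
  | succ i =>
    induction j using Fin.cases with
    | zero => exact absurd hij (Fin.not_lt_zero _)
    | succ j => simpa using hx (Fin.succ_lt_succ_iff.1 hij)

/-- Choose `f x` in `g (tail x)` but not in `g (init x)`. For consecutive tuples the same lower set
contains the first value and omits the second, so the second is not below the first. -/
theorem ShiftAvoiding.exists_of_lowerSet {m N : ℕ} {P : Type*} [PartialOrder P] [Nonempty P]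
    {g : (Fin m → Fin N) → LowerSet P} (hg : ShiftAvoiding g) :
    ∃ f : (Fin (m + 1) → Fin N) → P, ShiftAvoiding f := by
  have h : ∀ x : Fin (m + 1) → Fin N, ∃ p : P, StrictMono x →
      p ∈ g (Fin.tail x) ∧ p ∉ g (Fin.init x) := by
    intro x
    by_cases hx : StrictMono x
    · obtain ⟨p, hp⟩ := Set.not_subset.1 (hg x hx)
      exact ⟨p, fun _ => hp⟩
    · exact ⟨Classical.arbitrary P, fun h => absurd h hx⟩
  choose f hf using h
  refine ⟨f, fun x hx hle => ?_⟩
  have h1 := (hf _ hx.fin_init).1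
  have h2 := (hf _ hx.fin_tail).2
  exact h2 ((g _).lower hle h1)

/-- Shift-avoidance on single vertices forces injectivity; conversely, list elements of `P` in the
order of a linear extension. -/
theorem exists_shiftAvoiding_one_iff {N : ℕ} {P : Type*} [PartialOrder P] [Finite P] :
    (∃ f : (Fin 1 → Fin N) → P, ShiftAvoiding f) ↔ N ≤ Nat.card P := by
  constructor
  · rintro ⟨f, hf⟩
    have hne : ∀ a b : Fin N, a < b → f (fun _ => a) ≠ f (fun _ => b) := by
      intro a b hab h
      refine hf ![a, b] ?_ ?_
      · intro i j hij
        fin_cases i <;> fin_cases j <;> simp_all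
      · have h1 : (Fin.tail ![a, b] : Fin 1 → Fin N) = fun _ => b := by
          funext i; fin_cases i; rfl
        have h2 : (Fin.init ![a, b] : Fin 1 → Fin N) = fun _ => a := by
          funext i; fin_cases i; rfl
        rw [h1, h2, h]
    have hinj : Function.Injective fun a : Fin N => f (fun _ => a) := by
      intro a b hab
      by_contra hc
      rcases lt_or_gt_of_ne hc with h | h
      · exact hne a b h hab
      · exact hne b a h hab.symm
    simpa using Nat.card_le_card_of_injective _ hinj
  · intro h
    have : Fintype (LinearExtension P) := @Fintype.ofFinite _ ‹Finite P›
    have hc : Fintype.card (LinearExtension P) = Nat.card P := (Nat.card_eq_fintype_card).symm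
    let e := Fintype.orderIsoFinOfCardEq (LinearExtension P) hc
    let u : LinearExtension P → P := id
    refine ⟨fun x => u (e (Fin.castLE h (x 0))), fun x hx hle => ?_⟩
    have h1 := toLinearExtension.monotone hle
    have h2 : e (Fin.castLE h (x 1)) ≤ e (Fin.castLE h (x 0)) := h1
    rw [e.le_iff_le] at h2
    have h3 : x 0 < x 1 := hx (by decide)
    exact absurd h3 (not_lt.2 h2)

/-- The `j`-fold iteration of `P ↦ LowerSet P`. -/
def iterLowerSet (P : PartOrd.{0}) : ℕ → PartOrd.{0}
  | 0 => P
  | j + 1 => PartOrd.of (LowerSet (iterLowerSet P j))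

instance LowerSet.finite {P : Type*} [LE P] [Finite P] : Finite (LowerSet P) :=
  Finite.of_injective (fun s : LowerSet P => (s : Set P)) SetLike.coe_injective

theorem iterLowerSet_finite (P : PartOrd.{0}) [Finite P] (j : ℕ) : Finite (iterLowerSet P j) := by
  induction j with
  | zero => assumption
  | succ j ih => exact LowerSet.finite

theorem iterLowerSet_nonempty (P : PartOrd.{0}) [Nonempty P] (j : ℕ) :
    Nonempty (iterLowerSet P j) := by
  cases j with
  | zero => assumption
  | succ j => exact ⟨(⊥ : LowerSet (iterLowerSet P j))⟩

/-- The level `i` stays free because each step of the induction on `j` raises it by one. -/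
theorem exists_shiftAvoiding_iterLowerSet {N : ℕ} (P : PartOrd.{0}) [Finite P] [Nonempty P]
    (j i : ℕ) : (∃ f : (Fin (j + 1) → Fin N) → iterLowerSet P i, ShiftAvoiding f) ↔
      N ≤ Nat.card (iterLowerSet P (i + j)) := by
  induction j generalizing i with
  | zero =>
    have := iterLowerSet_finite P i
    exact exists_shiftAvoiding_one_iff
  | succ j ih =>
    have := iterLowerSet_nonempty P i
    rw [show i + (j + 1) = i + 1 + j by omega, ← ih (i + 1)]
    constructor
    · rintro ⟨f, hf⟩
      exact hf.exists_lowerSet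
    · rintro ⟨g, hg⟩
      exact ShiftAvoiding.exists_of_lowerSet (P := iterLowerSet P i) hg

/-! ### Colourings without long paths as shift-avoiding maps. -/

/-- There is a monotone path with `l` edges, all of colour `a`, whose last `m` vertices are `y`. -/
def IsMonoPathEnd {m q N : ℕ} (c : KEdge (m + 1) N → Fin q) (a : Fin q) (l : ℕ)
    (y : Fin m → Fin N) : Prop :=
  ∃ z : ℕ → Fin N, StrictMonoOn z (Set.Iio (l + m)) ∧ (∀ i : Fin m, z (l + i) = y i) ∧
    ∀ i < l, ∃ h : StrictMono fun j : Fin (m + 1) => z (i + j), c (edgeOfTuple _ h) = a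

theorem IsMonoPathEnd.zero {m q N : ℕ} (c : KEdge (m + 2) N → Fin q) (a : Fin q)
    {y : Fin (m + 1) → Fin N} (hy : StrictMono y) : IsMonoPathEnd c a 0 y := by
  -- Only the indices below `m + 1` matter; `y 0` is a filler.
  refine ⟨fun i => if h : i < m + 1 then y ⟨i, h⟩ else y 0, ?_, ?_, by simp⟩
  · intro i hi j hj hij
    simp only [zero_add, Set.mem_Iio] at hi hj
    simpa [hi, hj] using hy (a := ⟨i, hi⟩) (b := ⟨j, hj⟩) hij
  · intro i
    simp [i.2]

theorem IsMonoPathEnd.succ {m q N : ℕ} {c : KEdge (m + 1) N → Fin q} {a : Fin q} {l : ℕ}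
    (hm : 0 < m) {x : Fin (m + 1) → Fin N} (hx : StrictMono x) (hc : c (edgeOfTuple x hx) = a)
    (h : IsMonoPathEnd c a l (Fin.init x)) : IsMonoPathEnd c a (l + 1) (Fin.tail x) := by
  obtain ⟨z, hz, hzx, hza⟩ := h
  let w : ℕ → Fin N := Function.update z (l + m) (x (Fin.last m))
  have hw : ∀ i, i < l + m → w i = z i := fun i hi => Function.update_of_ne hi.ne _ _
  have hwl : w (l + m) = x (Fin.last m) := Function.update_self _ _ _
  have hwx : ∀ i : Fin (m + 1), w (l + i) = x i := by
    intro i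
    induction i using Fin.lastCases with
    | last => simpa using hwl
    | cast i => rw [Fin.val_castSucc, hw _ (by omega), hzx i]; rfl
  refine ⟨w, ?_, ?_, ?_⟩
  · intro i hi j hj hij
    simp only [Set.mem_Iio] at hi hj
    rcases lt_or_ge j (l + m) with hj' | hj'
    · rw [hw i (by omega), hw j hj']
      exact hz (Set.mem_Iio.2 (by omega)) (Set.mem_Iio.2 hj') hij
    · obtain rfl : j = l + m := by omega
      rcases lt_or_ge i l with hil | hil
      · have h1 : w i < w l := by
          rw [hw i (by omega), hw l (by omega)]
          exact hz (Set.mem_Iio.2 (by omega)) (Set.mem_Iio.2 (by omega)) hil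
        have h2 : w (l + (0 : Fin (m + 1))) ≤ w (l + Fin.last m) := by
          rw [hwx, hwx]; exact hx.monotone (Fin.zero_le _)
        simpa using h1.trans_le h2
      · have := hx (a := ⟨i - l, by omega⟩) (b := Fin.last m) (by rw [Fin.lt_def]; simp; omega)
        rw [← hwx, ← hwx] at this
        simpa [Nat.add_sub_cancel' hil] using this
  · intro i
    rw [show l + 1 + (i : ℕ) = l + (i.succ : Fin (m + 1)) by simp; omega, hwx]
    rfl
  · intro i hi
    rcases Nat.lt_succ_iff_lt_or_eq.1 hi with hi | rfl
    · have : (fun j : Fin (m + 1) => w (i + j)) = fun j : Fin (m + 1) => z (i + j) := by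
        funext j; exact hw _ (by omega)
      simp only [this]
      exact hza i hi
    · have : (fun j : Fin (m + 1) => w (i + j)) = x := funext hwx
      simp only [this]
      exact ⟨hx, hc⟩

theorem IsMonoPathEnd.hasMonoPath {m q N n : ℕ} {c : KEdge (m + 1) N → Fin q} {a : Fin q}
    {y : Fin m → Fin N} (h : IsMonoPathEnd c a n y) : HasMonoPath c n := by
  obtain ⟨z, hz, -, hza⟩ := h
  refine ⟨OrderEmbedding.ofStrictMono (fun i => z i) ?_, a, fun i => ?_⟩
  · intro i j hij
    exact hz (Set.mem_Iio.2 (by omega)) (Set.mem_Iio.2 (by omega)) hij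
  · obtain ⟨h, hc⟩ := hza i i.2
    exact hc

/-- An edge `x` of colour `a` prolongs every `a`-path ending in `init x`, so coordinate `a` of the
longest-path vector strictly grows. -/
theorem exists_shiftAvoiding_of_not_hasMonoPath {m q N n : ℕ} (hn : 0 < n)
    {c : KEdge (m + 2) N → Fin q} (hc : ¬ HasMonoPath c n) :
    ∃ f : (Fin (m + 1) → Fin N) → Fin q → Fin n, ShiftAvoiding f := by
  classical
  refine ⟨fun y a => ⟨Nat.findGreatest (fun l => IsMonoPathEnd c a l y) (n - 1),
    (Nat.findGreatest_le _).trans_lt (by omega)⟩, fun x hx hle => ?_⟩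
  have h1 := hle (c (edgeOfTuple x hx))
  rw [Fin.le_def] at h1
  dsimp only at h1
  set l := Nat.findGreatest (fun l => IsMonoPathEnd c (c (edgeOfTuple x hx)) l (Fin.init x)) (n - 1)
    with hl
  have h2 : IsMonoPathEnd c (c (edgeOfTuple x hx)) l (Fin.init x) :=
    Nat.findGreatest_spec (P := fun l => IsMonoPathEnd c (c (edgeOfTuple x hx)) l (Fin.init x))
      (Nat.zero_le _) (IsMonoPathEnd.zero c _ hx.fin_init)
  have h3 := h2.succ m.succ_pos hx rfl
  have h4 : l ≤ n - 1 := Nat.findGreatest_le _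
  have h5 : l + 1 ≠ n := fun h => hc (h ▸ h3).hasMonoPath
  have h6 := Nat.le_findGreatest
    (P := fun l => IsMonoPathEnd c (c (edgeOfTuple x hx)) l (Fin.tail x))
    (show l + 1 ≤ n - 1 by omega) h3
  omega

/-- Colour an edge by a coordinate in which `f` increases. Along a monochromatic path of length `n`
that coordinate would climb `n` times inside `Fin n`. -/
theorem exists_not_hasMonoPath_of_shiftAvoiding {m q N n : ℕ} (hq : 0 < q)
    {f : (Fin m → Fin N) → Fin q → Fin n} (hf : ShiftAvoiding f) :
    ∃ c : KEdge (m + 1) N → Fin q, ¬ HasMonoPath c n := by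
  have h : ∀ x : Fin (m + 1) → Fin N, ∃ a : Fin q, StrictMono x →
      f (Fin.init x) a < f (Fin.tail x) a := by
    intro x
    by_cases hx : StrictMono x
    · have := hf x hx
      simp only [Pi.le_def, not_forall, not_le] at this
      exact this.imp fun a ha _ => ha
    · exact ⟨⟨0, hq⟩, fun h => absurd h hx⟩
  choose C hC using h
  refine ⟨fun e => C (e.1.orderEmbOfFin e.2), ?_⟩
  rintro ⟨x, a, hx⟩
  have key : ∀ i : ℕ, ∀ hi : i ≤ n,
      i ≤ (f (fun j : Fin m => x ⟨i + j, by omega⟩) a : ℕ) := by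
    intro i
    induction i with
    | zero => intro _; exact Nat.zero_le _
    | succ i ih =>
      intro hi
      have h1 := ih (by omega)
      have hmono : StrictMono fun j : Fin (m + 1) => x ⟨i + j, by omega⟩ := by
        intro j j' hj
        exact x.strictMono (by rw [Fin.lt_def]; simpa using hj)
      have h2 : ((pathEdge x ⟨i, hi⟩).1.orderEmbOfFin (pathEdge x ⟨i, hi⟩).2 : Fin (m + 1) → Fin N)
          = fun j : Fin (m + 1) => x ⟨i + j, by omega⟩ := by
        refine (Finset.orderEmbOfFin_unique _ (fun j => ?_) hmono).symm
        exact Finset.mem_map.2 ⟨j, Finset.mem_univ _, rfl⟩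
      have h3 := hx ⟨i, hi⟩
      simp only [h2] at h3
      have h4 := hC _ hmono
      rw [h3, Fin.lt_def] at h4
      have h5 : (Fin.tail (fun j : Fin (m + 1) => x ⟨i + j, by omega⟩) : Fin m → Fin N)
          = fun j : Fin m => x ⟨i + 1 + j, by omega⟩ := by
        funext j
        simp only [Fin.tail, Fin.val_succ]
        congr 2
        omega
      rw [h5] at h4
      exact h1.trans_lt h4
  exact absurd (key n le_rfl) (by have := (f (fun j : Fin m => x ⟨n + j, by omega⟩) a).2; omega)

/-! ### The exact formula for the Ramsey number. -/

theorem mem_ramseySet_iff {m q n : ℕ} (hq : 0 < q) (hn : 0 < n) (N : ℕ) :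
    N ∈ ramseySet (m + 2) q n ↔
      Nat.card (iterLowerSet (PartOrd.of (Fin q → Fin n)) m) < N := by
  have : Finite (PartOrd.of (Fin q → Fin n)) := inferInstanceAs (Finite (Fin q → Fin n))
  have : Nonempty (PartOrd.of (Fin q → Fin n)) := ⟨fun _ => (⟨0, hn⟩ : Fin n)⟩
  have h := exists_shiftAvoiding_iterLowerSet (N := N) (PartOrd.of (Fin q → Fin n)) m 0
  rw [Nat.zero_add] at h
  rw [← not_le, ← h, ramseySet, Set.mem_ofPred_eq, ← not_exists_not, not_iff_not]
  constructor
  · rintro ⟨c, hc⟩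
    exact exists_shiftAvoiding_of_not_hasMonoPath hn hc
  · rintro ⟨f, hf⟩
    exact exists_not_hasMonoPath_of_shiftAvoiding (n := n) hq hf

theorem ramseySet_eq_Ici {m q n : ℕ} (hq : 0 < q) (hn : 0 < n) :
    ramseySet (m + 2) q n =
      Set.Ici (Nat.card (iterLowerSet (PartOrd.of (Fin q → Fin n)) m) + 1) := by
  ext N
  rw [mem_ramseySet_iff hq hn]
  exact Iff.rfl

theorem ramseyN_eq {m q n : ℕ} (hq : 0 < q) (hn : 0 < n) :
    ramseyN (m + 2) q n = Nat.card (iterLowerSet (PartOrd.of (Fin q → Fin n)) m) + 1 := by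
  rw [ramseyN, ramseySet_eq_Ici hq hn, csInf_Ici]

theorem ramseySet_nonempty {m q : ℕ} (hq : 0 < q) (n : ℕ) : (ramseySet (m + 2) q n).Nonempty := by
  rcases Nat.eq_zero_or_pos n with rfl | hn
  · exact ⟨0 + (m + 2) - 1, fun c => ⟨(OrderIso.refl _).toOrderEmbedding, ⟨0, hq⟩, fun i => i.elim0⟩⟩
  · rw [ramseySet_eq_Ici hq hn]
    exact Set.nonempty_Ici

theorem isLeast_ramseyN {m q : ℕ} (hq : 0 < q) (n : ℕ) :
    IsLeast (ramseySet (m + 2) q n) (ramseyN (m + 2) q n) :=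
  ⟨Nat.sInf_mem (ramseySet_nonempty hq n), fun _ h => Nat.sInf_le h⟩

/-! ### Size of the lattice of lower sets. -/

theorem two_pow_le_card_lowerSet_of_isAntichain {Q : Type*} [PartialOrder Q] [Finite Q]
    (s : Finset Q) (hs : IsAntichain (· ≤ ·) (s : Set Q)) :
    2 ^ s.card ≤ Nat.card (LowerSet Q) := by
  have key : ∀ t : s.powerset, ∀ a ∈ s, a ∈ lowerClosure (t.1 : Set Q) ↔ a ∈ t.1 := by
    intro t a ha
    refine ⟨fun h => ?_, fun h => subset_lowerClosure h⟩
    obtain ⟨b, hb, hab⟩ := mem_lowerClosure.1 h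
    rwa [hs.eq ha (Finset.mem_powerset.1 t.2 hb) hab]
  have hinj : Function.Injective fun t : s.powerset => lowerClosure (t.1 : Set Q) := by
    intro t t' h
    have h' : lowerClosure (t.1 : Set Q) = lowerClosure (t'.1 : Set Q) := h
    ext a
    constructor
    · intro ha
      have has := Finset.mem_powerset.1 t.2 ha
      rwa [← key t' a has, ← h', key t a has]
    · intro ha
      have has := Finset.mem_powerset.1 t'.2 ha
      rwa [← key t a has, h', key t' a has]
  have h := Nat.card_le_card_of_injective _ hinj
  rwa [Nat.card_eq_fintype_card, Fintype.card_coe, Finset.card_powerset] at h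

/-- Fibres of a strictly monotone map are antichains; pigeonhole picks a large one. -/
theorem exists_isAntichain_of_strictMono {Q : Type*} [PartialOrder Q] [Finite Q] {M : ℕ}
    (hM : 0 < M) (r : Q → Fin M) (hr : StrictMono r) :
    ∃ s : Finset Q, IsAntichain (· ≤ ·) (s : Set Q) ∧ Nat.card Q ≤ M * s.card := by
  classical
  have := Fintype.ofFinite Q
  have : Nonempty (Fin M) := ⟨⟨0, hM⟩⟩
  obtain ⟨b, hb⟩ : ∃ b : Fin M, Fintype.card Q ≤ M * (Finset.univ.filter (r · = b)).card := by
    by_contra! h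
    have h1 := Finset.card_eq_sum_card_fiberwise (s := (Finset.univ : Finset Q))
      (t := Finset.univ) (f := r) (fun _ _ => Finset.mem_coe.2 (Finset.mem_univ _))
    have h2 : ∑ b : Fin M, M * (Finset.univ.filter (r · = b)).card < ∑ b : Fin M, Fintype.card Q :=
      Finset.sum_lt_sum_of_nonempty Finset.univ_nonempty fun b _ => h b
    rw [← Finset.mul_sum, ← h1] at h2
    simp at h2
  refine ⟨_, fun x hx y hy hxy hle => ?_, by rwa [Nat.card_eq_fintype_card]⟩
  simp only [Finset.coe_filter, Finset.mem_univ, true_and, Set.mem_ofPred_eq] at hx hy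
  exact (hr (lt_of_le_of_ne hle hxy)).ne (hx.trans hy.symm)

theorem rpow_div_le_card_lowerSet_lowerSet (P : Type*) [PartialOrder P] [Finite P] :
    (2 : ℝ) ^ ((Nat.card (LowerSet P) : ℝ) / (Nat.card P + 1)) ≤
      Nat.card (LowerSet (LowerSet P)) := by
  -- Lower sets are ranked by cardinality, which takes at most `|P| + 1` values.
  obtain ⟨s, hs, hc⟩ := exists_isAntichain_of_strictMono (Nat.succ_pos (Nat.card P))
    (fun D : LowerSet P => ⟨(D : Set P).ncard, Nat.lt_succ_of_le (Set.ncard_le_card _)⟩)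
    (fun D E h => Set.ncard_lt_ncard (show (D : Set P) ⊂ E from h) (Set.toFinite _))
  have h1 : (Nat.card (LowerSet P) : ℝ) / (Nat.card P + 1) ≤ s.card := by
    rw [div_le_iff₀ (by positivity), mul_comm]
    exact_mod_cast hc
  calc (2 : ℝ) ^ ((Nat.card (LowerSet P) : ℝ) / (Nat.card P + 1)) ≤ (2 : ℝ) ^ (s.card : ℝ) :=
        Real.rpow_le_rpow_of_exponent_le one_le_two h1
    _ ≤ _ := by
        rw [Real.rpow_natCast]
        exact_mod_cast two_pow_le_card_lowerSet_of_isAntichain s hs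

theorem card_lowerSet_le_two_pow (P : Type*) [PartialOrder P] [Finite P] :
    Nat.card (LowerSet P) ≤ 2 ^ Nat.card P := by
  have := Fintype.ofFinite P
  have h := Nat.card_le_card_of_injective (fun s : LowerSet P => (s : Set P)) SetLike.coe_injective
  simpa using h

/-! ### Lower sets of the square grid. -/

theorem card_orderEmbedding_fin_two_mul (n : ℕ) :
    Nat.card (Fin n ↪o Fin (2 * n)) = n.centralBinom := by
  rw [Nat.card_congr Set.powersetCard.ofFinEmbEquiv, Set.powersetCard.card, Nat.card_fin,
    Nat.centralBinom_eq_two_mul_choose]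

theorem OrderEmbedding.val_add_le_val_add {n M : ℕ} (s : Fin n ↪o Fin M) {i j : Fin n}
    (h : i ≤ j) : (s i : ℕ) + j ≤ s j + i := by
  obtain ⟨d, hd⟩ := Nat.exists_eq_add_of_le (Fin.le_def.1 h)
  induction d generalizing j with
  | zero => rw [show j = i from Fin.ext (by omega)]
  | succ d ih =>
    have hj : (i : ℕ) + d < n := by omega
    have h1 := ih (j := ⟨i + d, hj⟩) (by rw [Fin.le_def]; simp) rfl
    have h2 : s ⟨i + d, hj⟩ < s j := s.strictMono (by rw [Fin.lt_def]; dsimp only; omega)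
    rw [Fin.lt_def] at h2
    dsimp only at h1
    omega

theorem OrderEmbedding.val_le_val {n M : ℕ} (s : Fin n ↪o Fin M) (i : Fin n) :
    (i : ℕ) ≤ s i := by
  have := s.val_add_le_val_add (i := ⟨0, i.pos⟩) (j := i) (Fin.le_def.2 (Nat.zero_le _))
  dsimp only at this
  omega

theorem OrderEmbedding.val_le_add_val {n : ℕ} (s : Fin n ↪o Fin (2 * n)) (i : Fin n) :
    (s i : ℕ) ≤ n + i := by
  have := s.val_add_le_val_add (i := i) (j := ⟨n - 1, Nat.sub_one_lt_of_lt i.2⟩) (Fin.le_def.2 (Nat.le_sub_one_of_lt i.2))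
  dsimp only at this
  have := (s ⟨n - 1, Nat.sub_one_lt_of_lt i.2⟩).2
  omega

/-- The numbers `s i - i` increase weakly from 0 to at most `n`, so they serve as the column heights
of a lower set once the first coordinate is reversed. -/
theorem centralBinom_le_card_lowerSet (n : ℕ) :
    n.centralBinom ≤ Nat.card (LowerSet (Fin 2 → Fin n)) := by
  rw [← card_orderEmbedding_fin_two_mul]
  let D : (Fin n ↪o Fin (2 * n)) → LowerSet (Fin 2 → Fin n) := fun s =>
    ⟨{p | (p 1 : ℕ) + (p 0).rev < s (p 0).rev}, by
      intro p p' h hp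
      rw [Set.mem_ofPred_eq] at hp ⊢
      have h0 := s.val_add_le_val_add (Fin.rev_le_rev.2 (h 0))
      have h1 := Fin.le_def.1 (h 1)
      omega⟩
  have hD : ∀ s (i j : Fin n), (![i.rev, j] : Fin 2 → Fin n) ∈ D s ↔ (j : ℕ) + i < s i := by
    intro s i j
    change ((![i.rev, j] 1 : Fin n) : ℕ) + ((![i.rev, j] 0).rev : Fin n) < s (![i.rev, j] 0).rev ↔ _
    simp
  refine Nat.card_le_card_of_injective D fun s t hst => ?_
  have key : ∀ s t, D s = D t → ∀ i, (s i : ℕ) ≤ t i := by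
    intro s t hst i
    by_contra! hlt
    have h1 := t.val_le_val i
    have h2 := s.val_le_add_val i
    -- The lowest cell of column `i` missing from `D t`; it lies in `D s`.
    have h3 := hD s i ⟨t i - i, by omega⟩
    rw [hst, hD] at h3
    dsimp only at h3
    omega
  ext i
  exact le_antisymm (key s t hst i) (key t s hst.symm i)

/-- Adding `i` to the height of the `i`-th reversed column makes the sequence strictly increasing;
heights determine the columns, which are lower sets of a chain. -/
theorem card_lowerSet_le_centralBinom (n : ℕ) :
    Nat.card (LowerSet (Fin 2 → Fin n)) ≤ n.centralBinom := by
  classical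
  rw [← card_orderEmbedding_fin_two_mul]
  let F : LowerSet (Fin 2 → Fin n) → Fin n → Finset (Fin n) := fun D i =>
    Finset.univ.filter fun j => (![i.rev, j] : Fin 2 → Fin n) ∈ D
  have hmono : ∀ D, Monotone (F D) := by
    intro D i i' h j hj
    simp only [F, Finset.mem_filter, Finset.mem_univ, true_and] at hj ⊢
    refine D.lower ?_ hj
    intro a
    fin_cases a
    · simpa using h
    · simp
  have hF : ∀ D i, (F D i).card ≤ n := fun D i => by simpa using Finset.card_le_univ (F D i)
  let s : LowerSet (Fin 2 → Fin n) → (Fin n ↪o Fin (2 * n)) := fun D =>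
    OrderEmbedding.ofStrictMono (fun i => ⟨(F D i).card + i, by have := hF D i; omega⟩) (by
      intro i i' h
      rw [Fin.lt_def]
      have h1 := Finset.card_le_card (hmono D h.le)
      have h2 := Fin.lt_def.1 h
      dsimp only
      omega)
  refine Nat.card_le_card_of_injective s fun D E h => ?_
  have hc : ∀ i, (F D i).card = (F E i).card := by
    intro i
    have := congrArg Fin.val (DFunLike.congr_fun h i)
    change (F D i).card + (i : ℕ) = (F E i).card + i at this
    omega
  have hlow : ∀ D i, IsLowerSet (F D i : Set (Fin n)) := by
    intro D i j j' h hj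
    simp only [F, Finset.coe_filter, Finset.mem_univ, true_and, Set.mem_ofPred_eq] at hj ⊢
    refine D.lower ?_ hj
    intro a
    fin_cases a
    · simp
    · simpa using h
  have heq : ∀ i, F D i = F E i := by
    intro i
    rcases (hlow D i).total (hlow E i) with h | h
    · exact Finset.eq_of_subset_of_card_le h (hc i).ge
    · exact (Finset.eq_of_subset_of_card_le h (hc i).le).symm
  have hp : ∀ (D : LowerSet (Fin 2 → Fin n)) (p : Fin 2 → Fin n), p ∈ D ↔ p 1 ∈ F D (p 0).rev := by
    intro D p
    have : ![p 0, p 1] = p := by funext a; fin_cases a <;> rfl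
    simp [F, this]
  ext p
  change p ∈ D ↔ p ∈ E
  rw [hp, hp, heq]

/-! ### Tower estimates. -/

theorem strictMono_two_rpow : StrictMono fun y : ℝ => (2 : ℝ) ^ y :=
  fun _ _ h => Real.rpow_lt_rpow_of_exponent_lt one_lt_two h

theorem two_le_iterate_two_rpow (j : ℕ) {x : ℝ} (hx : 2 ≤ x) :
    2 ≤ (fun y : ℝ => (2 : ℝ) ^ y)^[j] x := by
  induction j with
  | zero => exact hx
  | succ j ih =>
    rw [Function.iterate_succ_apply']
    calc (2 : ℝ) = 2 ^ (1 : ℝ) := (Real.rpow_one 2).symm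
      _ ≤ _ := strictMono_two_rpow.monotone (by linarith)

/-- For numbers at least 2 the sum is at most the product, so the bound passes up the tower. -/
theorem iterate_two_rpow_mul_le (j : ℕ) {u v w : ℝ} (hu : 2 ≤ u) (hv : 2 ≤ v) (h : u * v ≤ w) :
    (fun y : ℝ => (2 : ℝ) ^ y)^[j] u * (fun y : ℝ => (2 : ℝ) ^ y)^[j] v ≤
      (fun y : ℝ => (2 : ℝ) ^ y)^[j] w := by
  induction j with
  | zero => exact h
  | succ j ih =>
    simp only [Function.iterate_succ_apply']
    have h1 := two_le_iterate_two_rpow j hu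
    have h2 := two_le_iterate_two_rpow j hv
    rw [← Real.rpow_add two_pos]
    exact strictMono_two_rpow.monotone (le_trans (by nlinarith) ih)

theorem eventually_two_rpow_mul_sq_add_one_le {c a : ℝ} (h : c < a) :
    ∀ᶠ n : ℕ in atTop, (2 : ℝ) ^ (c * n) * ((n : ℝ) ^ 2 + 1) ≤ 2 ^ (a * n) := by
  have hr : 1 < (2 : ℝ) ^ (a - c) := Real.one_lt_rpow one_lt_two (sub_pos.2 h)
  filter_upwards [(isLittleO_pow_const_const_pow_of_one_lt (R := ℝ) 2 hr).bound
    (show (0 : ℝ) < 1 / 2 by norm_num), eventually_ge_atTop 1] with n hn hn1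
  have hn1' : (1 : ℝ) ≤ n := by exact_mod_cast hn1
  have hpos : 0 < ((2 : ℝ) ^ (a - c)) ^ n := by positivity
  rw [Real.norm_of_nonneg (by positivity), Real.norm_of_nonneg hpos.le] at hn
  have h1 : (n : ℝ) ^ 2 + 1 ≤ ((2 : ℝ) ^ (a - c)) ^ n := by nlinarith
  calc (2 : ℝ) ^ (c * n) * ((n : ℝ) ^ 2 + 1) ≤ 2 ^ (c * n) * ((2 : ℝ) ^ (a - c)) ^ n := by gcongr
    _ = 2 ^ (a * n) := by
        rw [← Real.rpow_mul_natCast two_pos.le, ← Real.rpow_add two_pos]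
        congr 1
        ring

/-- The number of elements of the `j`-fold iterated lattice of lower sets over `{1, …, n}²`. -/
noncomputable def iterLowerSetCard (n j : ℕ) : ℕ :=
  Nat.card (iterLowerSet (PartOrd.of (Fin 2 → Fin n)) j)

theorem iterLowerSetCard_zero (n : ℕ) : iterLowerSetCard n 0 = n ^ 2 := by
  change Nat.card (Fin 2 → Fin n) = n ^ 2
  simp

theorem iterLowerSetCard_one (n : ℕ) : iterLowerSetCard n 1 = n.centralBinom :=
  le_antisymm (card_lowerSet_le_centralBinom n) (centralBinom_le_card_lowerSet n)

theorem iterLowerSetCard_succ_le (n j : ℕ) :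
    iterLowerSetCard n (j + 1) ≤ 2 ^ iterLowerSetCard n j := by
  have : Finite (PartOrd.of (Fin 2 → Fin n)) := inferInstanceAs (Finite (Fin 2 → Fin n))
  have := iterLowerSet_finite (PartOrd.of (Fin 2 → Fin n)) j
  exact card_lowerSet_le_two_pow _

theorem two_rpow_div_le_iterLowerSetCard (n j : ℕ) :
    (2 : ℝ) ^ ((iterLowerSetCard n (j + 1) : ℝ) / (iterLowerSetCard n j + 1)) ≤
      iterLowerSetCard n (j + 2) := by
  have : Finite (PartOrd.of (Fin 2 → Fin n)) := inferInstanceAs (Finite (Fin 2 → Fin n))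
  have := iterLowerSet_finite (PartOrd.of (Fin 2 → Fin n)) j
  exact rpow_div_le_card_lowerSet_lowerSet _

/-- The extra 1 survives each level because `2^N + 1 ≤ 2^(N+1)`. -/
theorem iterLowerSetCard_add_one_le {n i : ℕ} {x : ℝ} (h : (iterLowerSetCard n i : ℝ) + 1 ≤ x)
    (j : ℕ) : (iterLowerSetCard n (i + j) : ℝ) + 1 ≤ (fun y : ℝ => (2 : ℝ) ^ y)^[j] x := by
  induction j with
  | zero => exact h
  | succ j ih =>
    rw [Function.iterate_succ_apply']
    have h1 : (iterLowerSetCard n (i + j + 1) : ℝ) ≤ 2 ^ iterLowerSetCard n (i + j) := by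
      exact_mod_cast iterLowerSetCard_succ_le n (i + j)
    have h2 : (1 : ℝ) ≤ 2 ^ iterLowerSetCard n (i + j) := one_le_pow₀ one_le_two
    calc (iterLowerSetCard n (i + (j + 1)) : ℝ) + 1 ≤ 2 ^ iterLowerSetCard n (i + j) * 2 := by
          rw [← add_assoc]; linarith
      _ = 2 ^ ((iterLowerSetCard n (i + j) : ℝ) + 1) := by
          rw [Real.rpow_add two_pos, Real.rpow_natCast, Real.rpow_one]
      _ ≤ _ := strictMono_two_rpow.monotone ih

theorem iterLowerSetCard_add_one_le_two_mul {n : ℕ} (hn : n ≠ 0) (j : ℕ) :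
    (iterLowerSetCard n (j + 1) : ℝ) + 1 ≤ (fun y : ℝ => (2 : ℝ) ^ y)^[j + 1] (2 * n) := by
  rw [Function.iterate_succ_apply, add_comm j 1]
  refine iterLowerSetCard_add_one_le ?_ j
  rw [iterLowerSetCard_one]
  have h : n.centralBinom + 1 ≤ 2 ^ (2 * n) := by
    rw [pow_mul]
    exact Nat.centralBinom_lt_four_pow hn
  calc (n.centralBinom : ℝ) + 1 ≤ 2 ^ (2 * n) := by exact_mod_cast h
    _ = 2 ^ (2 * (n : ℝ)) := by rw [← Real.rpow_natCast]; push_cast; rfl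

theorem eventually_two_rpow_le_centralBinom {c : ℝ} (hc : c < 2) :
    ∀ᶠ n : ℕ in atTop, (2 : ℝ) ^ (c * n) ≤ n.centralBinom := by
  filter_upwards [eventually_two_rpow_mul_sq_add_one_le hc, eventually_ge_atTop 1] with n hn hn1
  have h1 : ((4 : ℝ)) ^ n ≤ 2 * n * n.centralBinom := by
    exact_mod_cast Nat.four_pow_le_two_mul_self_mul_centralBinom n hn1
  have h2 : (2 : ℝ) ^ (2 * (n : ℝ)) = 4 ^ n := by
    rw [Real.rpow_mul two_pos.le, Real.rpow_natCast]; norm_num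
  have h3 : (2 : ℝ) * n ≤ n ^ 2 + 1 := by nlinarith [sq_nonneg ((n : ℝ) - 1)]
  have h4 : (0 : ℝ) < (n : ℝ) ^ 2 + 1 := by positivity
  rw [h2] at hn
  refine le_of_mul_le_mul_right (hn.trans (h1.trans ?_)) h4
  rw [mul_comm]
  gcongr

/-- The antichain bound divides by the size two levels down, a tower over `n^2 + 1`. Passing from
`a` to a smaller `c` pays for it, since `2^(cn) (n^2 + 1) ≤ 2^(an)` eventually. -/
theorem eventually_iterate_le_iterLowerSetCard (j : ℕ) {c : ℝ} (hc0 : 0 < c) (hc : c < 2) :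
    ∀ᶠ n : ℕ in atTop,
      (fun y : ℝ => (2 : ℝ) ^ y)^[j + 1] (c * n) ≤ iterLowerSetCard n (j + 1) := by
  induction j generalizing c with
  | zero =>
    filter_upwards [eventually_two_rpow_le_centralBinom hc] with n hn
    rw [iterLowerSetCard_one]
    exact hn
  | succ j ih =>
    obtain ⟨a, hca, ha⟩ := exists_between hc
    filter_upwards [ih (hc0.trans hca) ha, eventually_two_rpow_mul_sq_add_one_le hca,
      eventually_ge_atTop 1, (tendsto_natCast_atTop_atTop.const_mul_atTop hc0).eventually_ge_atTop 1]
      with n h1 h2 hn hcn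
    have hn' : (1 : ℝ) ≤ n := by exact_mod_cast hn
    have hu : 2 ≤ (2 : ℝ) ^ (c * n) := by
      calc (2 : ℝ) = 2 ^ (1 : ℝ) := (Real.rpow_one 2).symm
        _ ≤ _ := strictMono_two_rpow.monotone hcn
    have h3 := iterate_two_rpow_mul_le j hu (by nlinarith) h2
    have h4 : (iterLowerSetCard n (0 + j) : ℝ) + 1 ≤ _ :=
      iterLowerSetCard_add_one_le (x := (n : ℝ) ^ 2 + 1) (by rw [iterLowerSetCard_zero]; simp) j
    rw [zero_add] at h4
    have h5 := two_le_iterate_two_rpow j hu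
    rw [Function.iterate_succ_apply']
    refine le_trans (strictMono_two_rpow.monotone ?_) (two_rpow_div_le_iterLowerSetCard n j)
    rw [le_div_iff₀ (by positivity)]
    rw [Function.iterate_succ_apply] at h1 ⊢
    exact (mul_le_mul_of_nonneg_left h4 (by linarith)).trans (h3.trans h1)

/-! ### Extraction of the error term and conclusion. -/

/-- Solve `F (Y n) = M n` by the intermediate value theorem and put `ε n = a - Y n / n`. The upper
bound gives `ε n ≥ 0`; the lower bounds with `c` near `a` give convergence. -/
theorem exists_tendsto_zero_eq_iterate {F : ℝ → ℝ} (hF : StrictMono F) (hFc : Continuous F) {a : ℝ}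
    (ha : 0 < a) {M : ℕ → ℝ} (hup : ∀ᶠ n : ℕ in atTop, M n ≤ F (a * n))
    (hlow : ∀ c, 0 < c → c < a → ∀ᶠ n : ℕ in atTop, F (c * n) ≤ M n) :
    ∃ ε : ℕ → ℝ, Tendsto ε atTop (𝓝 0) ∧
      ∀ᶠ n : ℕ in atTop, 0 ≤ ε n ∧ M n = F ((a - ε n) * n) := by
  have hY : ∀ n : ℕ, ∃ y : ℝ, F 0 ≤ M n → M n ≤ F (a * n) → y ≤ a * n ∧ F y = M n := by
    intro n
    by_cases h : F 0 ≤ M n ∧ M n ≤ F (a * n)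
    · obtain ⟨y, hy, hyM⟩ := intermediate_value_Icc (show 0 ≤ a * (n : ℝ) by positivity)
        hFc.continuousOn (Set.mem_Icc.2 h)
      exact ⟨y, fun _ _ => ⟨hy.2, hyM⟩⟩
    · exact ⟨0, fun h1 h2 => absurd ⟨h1, h2⟩ h⟩
  choose Y hY using hY
  have hY' : ∀ᶠ n : ℕ in atTop, Y n ≤ a * n ∧ F (Y n) = M n := by
    filter_upwards [hup, hlow (a / 2) (by positivity) (by linarith)] with n h1 h2
    exact hY n ((hF.monotone (by positivity)).trans h2) h1
  have hnonneg : ∀ᶠ n : ℕ in atTop, 0 ≤ a - Y n / n := by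
    filter_upwards [hY', eventually_gt_atTop 0] with n h hn
    rw [sub_nonneg, div_le_iff₀ (by exact_mod_cast hn)]
    exact h.1
  refine ⟨fun n => a - Y n / n, tendsto_order.2 ⟨fun b hb => ?_, fun b hb => ?_⟩, ?_⟩
  · filter_upwards [hnonneg] with n h
    exact hb.trans_le h
  · have hc : max (a / 2) (a - b / 2) < a := max_lt (by linarith) (by linarith)
    filter_upwards [hY', hlow _ (lt_max_of_lt_left (by positivity)) hc, eventually_gt_atTop 0]
      with n h h1 hn
    rw [← h.2, hF.le_iff_le, ← le_div_iff₀ (by exact_mod_cast hn)] at h1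
    have := le_max_right (a / 2) (a - b / 2)
    linarith
  · filter_upwards [hnonneg, hY', eventually_gt_atTop 0] with n h0 h hn
    refine ⟨h0, ?_⟩
    have : (n : ℝ) ≠ 0 := by exact_mod_cast hn.ne'
    rw [sub_sub_cancel, div_mul_cancel₀ _ this, h.2]

theorem mainTheorem5 (k : ℕ) (hk : 3 ≤ k) :
    (∀ n : ℕ, IsLeast (ramseySet k 2 n) (ramseyN k 2 n)) ∧
    (∃ ε : ℕ → ℝ, Tendsto ε atTop (𝓝 0) ∧
      ∀ᶠ n : ℕ in atTop, 0 ≤ ε n ∧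
        (ramseyN k 2 n : ℝ) = tower (k - 1) ((2 - ε n) * (n : ℝ))) ∧
    (∃ a b : ℝ, 0 < a ∧ 0 < b ∧
      ∀ᶠ n : ℕ in atTop, tower (k - 1) (a * (n : ℝ)) ≤ (ramseyN k 2 n : ℝ) ∧
        (ramseyN k 2 n : ℝ) ≤ tower (k - 1) (b * (n : ℝ))) := by
  obtain ⟨j, rfl⟩ : ∃ j, k = j + 1 + 2 := ⟨k - 3, by omega⟩
  have htower : tower (j + 1 + 2 - 1) = (fun y : ℝ => (2 : ℝ) ^ y)^[j + 1] := rfl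
  have hN : ∀ᶠ n : ℕ in atTop,
      (ramseyN (j + 1 + 2) 2 n : ℝ) = (iterLowerSetCard n (j + 1) : ℝ) + 1 := by
    filter_upwards [eventually_gt_atTop 0] with n hn
    rw [ramseyN_eq two_pos hn]
    push_cast
    rfl
  have hup : ∀ᶠ n : ℕ in atTop,
      (ramseyN (j + 1 + 2) 2 n : ℝ) ≤ tower (j + 1 + 2 - 1) (2 * n) := by
    filter_upwards [hN, eventually_ne_atTop 0] with n h hn
    rw [h, htower]
    exact iterLowerSetCard_add_one_le_two_mul hn j
  have hlow : ∀ c : ℝ, 0 < c → c < 2 → ∀ᶠ n : ℕ in atTop,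
      tower (j + 1 + 2 - 1) (c * n) ≤ (ramseyN (j + 1 + 2) 2 n : ℝ) := by
    intro c hc0 hc
    filter_upwards [hN, eventually_iterate_le_iterLowerSetCard j hc0 hc] with n h h1
    rw [h, htower]
    linarith
  refine ⟨isLeast_ramseyN two_pos, ?_, 1, 2, one_pos, two_pos,
    (hlow 1 one_pos one_lt_two).and hup⟩
  refine exists_tendsto_zero_eq_iterate ?_ ?_ two_pos hup hlow
  · rw [htower]
    exact strictMono_two_rpow.iterate _
  · rw [htower]
    exact (Real.continuous_const_rpow two_ne_zero).iterate _
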